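/- Let $\mathbb{D}$ be the open unit disc and $\mathbb{T}$ the unit circle. A closed set $E\subset\mathbb{T}$ of Lebesgue measure zero is a Beurling–Carleson set if $\sum_k |I_k|\log(1/|I_k|)<\infty$, where $(I_k)_k$ are the maximal open arcs of $\mathbb{T}\setminus E$ and $|I_k|$ denotes arc length. For a finite positive Borel measure $\nu$ on $\mathbb{T}$, singular with respect to Lebesgue measure, let $$S_\nu(z)=\exp\Big(-\int_{\mathbb{T}}\frac{\zeta+z}{\zeta-z}\,d\nu(\zeta)\Big),\qquad z\in\mathbb{D},$$ be the associated singular inner function. Let $\mathcal{A}^\infty=\bigcap_{n\ge 1}\mathcal{A}^n$, where $\mathcal{A}^n$ is the class of analytic functions on $\mathbb{D}$ whose derivative of order $n$ extends continuously to $\overline{\mathbb{D}}$. The boundary function of a function on $\mathbb{D}$ is its nontangential limit, defined almost everywhere on $\mathbb{T}$, and functions that agree almost everywhere are identified. Proposition. Let $\nu$ be a finite positive Borel measure on $\mathbb{T}$ supported on a Beurling–Carleson set $E$ (that is, $\nu(\mathbb{T}\setminus E)=0$; in particular $\nu$ is singular). Then there exists a sequence $(H_n)_n$ of functions in $\mathcal{A}^\infty$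 such that (i) for every $n$, the boundary function of $S_\nu\overline{H_n}$ exists and is of class $C^\infty(\mathbb{T})$; (ii) $\lim_{n\to\infty}H_n(\zeta)=1$ for Lebesgue almost every $\zeta\in\mathbb{T}$, where $H_n(\zeta)$ denotes the boundary value of $H_n$; (iii) $\sup_n\|H_n\|_\infty<\infty$, where $\|H_n\|_\infty=\sup_{z\in\mathbb{D}}|H_n(z)|$. -/

import Mathlib

open MeasureTheory Filter Topology

noncomputable section

namespace ModelSpace

instance : MeasurableSpace Circle := borel Circle

instance : BorelSpace Circle := ⟨rfl⟩

/-- Arc length measure on the unit circle (total mass `2π`). -/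
def arcLength : Measure Circle :=
  (volume.restrict (Set.Ioc (-Real.pi) Real.pi)).map Circle.exp

/-- The maximal open arcs complementary to `E`: the connected components of `𝕋 \ E`. -/
def complementaryArcs (E : Set Circle) : Set (Set Circle) :=
  {I | ∃ ζ ∈ Eᶜ, I = connectedComponentIn Eᶜ ζ}

/-- Beurling–Carleson sets: closed null sets with `∑ |I| log (1 / |I|) < ∞`, the sum being
over the complementary arcs. At most finitely many terms are negative. -/
structure IsBeurlingCarleson (E : Set Circle) : Prop where
  isClosed : IsClosed E
  null : arcLength E = 0
  entropy : Summable fun (I : complementaryArcs E) ↦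
    arcLength.real (I : Set Circle) * Real.log (1 / arcLength.real (I : Set Circle))

/-- The singular inner function `S_ν(z) = exp (-∫ (ζ + z) / (ζ - z) dν(ζ))`, `z ∈ 𝔻`. -/
def singularInner (ν : Measure Circle) (z : ℂ) : ℂ :=
  Complex.exp (-∫ ζ : Circle, ((ζ : ℂ) + z) / ((ζ : ℂ) - z) ∂ν)

/-- The class `𝒜ⁿ`: `f` is analytic in `𝔻` and `f⁽ⁿ⁾` extends continuously to the closed disc. -/
def MemA (n : ℕ) (f : ℂ → ℂ) : Prop :=
  DifferentiableOn ℂ f (Metric.ball 0 1) ∧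
    ∃ F : ℂ → ℂ, ContinuousOn F (Metric.closedBall 0 1) ∧
      Set.EqOn F (iteratedDeriv n f) (Metric.ball 0 1)

/-- The class `𝒜^∞ = ⋂_{n ≥ 1} 𝒜ⁿ`. -/
def MemAInfty (f : ℂ → ℂ) : Prop := ∀ n : ℕ, 1 ≤ n → MemA n f

/-- The Stolz (nontangential approach) region in `𝔻` with vertex `ζ` and aperture `M`. -/
def stolzRegion (ζ : Circle) (M : ℝ) : Set ℂ :=
  {z | ‖z‖ < 1 ∧ ‖z - ζ‖ < M * (1 - ‖z‖)}

/-- `u` is the boundary function of the function `f` on `𝔻`: at almost every `ζ ∈ 𝕋`, the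
nontangential limit of `f` exists and equals `u ζ`. It determines `u` almost everywhere. -/
def HasBoundaryFunction (f : ℂ → ℂ) (u : Circle → ℂ) : Prop :=
  ∀ᵐ ζ : Circle ∂arcLength, ∀ M : ℝ, 1 < M → Tendsto f (𝓝[stolzRegion ζ M] (ζ : ℂ)) (𝓝 (u ζ))

/-- `u` is of class `C^∞(𝕋)`: infinitely differentiable as a function of the angle. -/
def SmoothOnCircle (u : Circle → ℂ) : Prop :=
  ContDiff ℝ ((⊤ : ℕ∞) : WithTop ℕ∞) fun t : ℝ ↦ u (Circle.exp t)

end ModelSpace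

end

/-!
Since `E` is a Beurling–Carleson set, `log (1 / dist(·, E))` is integrable. By the argument of de
la Vallée-Poussin there is a finite measure `μ` which, near `E`, is denser than every multiple of
`log (1 / dist(·, E))` times arc length. Move its mass from `ζ` to the pole `(1 + dist(ζ, E)) ζ`
outside the disc: the Herglotz integral `G` of the displaced measure is analytic across `𝕋 \ E`,
has nonnegative real part in the disc, and `exp (-ε G)` vanishes at `E` faster than every power of
the distance. On a disc of radius comparable to `dist(z, E) ^ 2` the Herglotz integrals of `μ` and
of `ν` oscillate by at most `1`, so Cauchy's estimates lose only powers of the distance, and the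
rapid decay absorbs them: `exp (-ε G)` is in `𝒜^∞`, and `S_ν` times its conjugate is smooth on the
circle and flat on `E`. Take `H_n = exp (-G / (n + 1))`.
-/

namespace ModelSpace

open scoped ContDiff

section Flatness

lemma norm_iteratedDeriv_mul_le_of_le {𝕜 𝔸 : Type*} [NontriviallyNormedField 𝕜] [NormedRing 𝔸]
    [NormedAlgebra 𝕜 𝔸] {f g : 𝕜 → 𝔸} {x : 𝕜} {k : ℕ} (hf : ContDiffAt 𝕜 k f x)
    (hg : ContDiffAt 𝕜 k g x) {a b : ℕ → ℝ} {p q δ : ℝ}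
    (hfa : ∀ i, ‖iteratedDeriv i f x‖ ≤ a i * p / δ ^ i)
    (hgb : ∀ i, ‖iteratedDeriv i g x‖ ≤ b i * q / δ ^ i) :
    ‖iteratedDeriv k (fun y ↦ f y * g y) x‖
      ≤ (∑ i ∈ Finset.range (k + 1), k.choose i * a i * b (k - i)) * (p * q) / δ ^ k := by
  rw [iteratedDeriv_fun_mul hf hg, Finset.sum_mul, Finset.sum_div]
  refine norm_sum_le_of_le _ fun i hi ↦ ?_
  have hδ : δ ^ k = δ ^ i * δ ^ (k - i) := by
    rw [← pow_add, Nat.add_sub_cancel' (Finset.mem_range_succ_iff.1 hi)]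
  calc ‖k.choose i * iteratedDeriv i f x * iteratedDeriv (k - i) g x‖
      ≤ k.choose i * (‖iteratedDeriv i f x‖ * ‖iteratedDeriv (k - i) g x‖) := by
        rw [mul_assoc, ← nsmul_eq_mul]
        exact (norm_nsmul_le).trans (by gcongr; exact norm_mul_le _ _)
    _ ≤ k.choose i * (a i * p / δ ^ i * (b (k - i) * q / δ ^ (k - i))) := by
        gcongr
        exacts [(norm_nonneg _).trans (hfa i), hfa i, hgb (k - i)]
    _ = k.choose i * a i * b (k - i) * (p * q) / δ ^ k := by
        rw [hδ]
        ring

lemma norm_iteratedDeriv_linearIsometryEquiv_comp {𝕜 F G : Type*} [NontriviallyNormedField 𝕜]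
    [NormedAddCommGroup F] [NormedSpace 𝕜 F] [NormedAddCommGroup G] [NormedSpace 𝕜 G]
    (L : F ≃ₗᵢ[𝕜] G) (f : 𝕜 → F) (k : ℕ) (x : 𝕜) :
    ‖iteratedDeriv k (fun y ↦ L (f y)) x‖ = ‖iteratedDeriv k f x‖ := by
  rw [← norm_iteratedFDeriv_eq_norm_iteratedDeriv, ← norm_iteratedFDeriv_eq_norm_iteratedDeriv]
  exact L.norm_iteratedFDeriv_comp_left f x k

variable {𝕜 F : Type*} [NontriviallyNormedField 𝕜] [NormedAddCommGroup F] [NormedSpace 𝕜 F]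

lemma contDiff_of_flat {f : 𝕜 → F} {Z : Set 𝕜} (hZ : IsClosed Z) (hfZ : ∀ t ∈ Z, f t = 0)
    (hf : ContDiffOn 𝕜 ∞ f Zᶜ)
    (hb : ∀ k : ℕ, ∃ C : ℝ, ∀ t ∉ Z, ∀ s ∈ Z, ‖iteratedDeriv k f t‖ ≤ C * ‖t - s‖ ^ 2) :
    ContDiff 𝕜 ∞ f := by
  have hderiv : ∀ k : ℕ, (∀ t ∈ Z, iteratedDeriv k f t = 0) →
      ∀ t ∈ Z, HasDerivAt (iteratedDeriv k f) 0 t := by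
    intro k hk t ht
    obtain ⟨C, hC⟩ := hb k
    have h : (iteratedDeriv k f) =O[𝓝 t] fun x ↦ ‖x - t‖ ^ 2 := by
      refine Asymptotics.IsBigO.of_bound |C| (Eventually.of_forall fun x ↦ ?_)
      rw [norm_pow, norm_norm]
      by_cases hx : x ∈ Z
      · rw [hk x hx, norm_zero]
        positivity
      · exact (hC x hx t ht).trans (by gcongr; exact le_abs_self C)
    simpa using (h.hasFDerivAt one_lt_two).hasDerivAt
  have hzero : ∀ k : ℕ, ∀ t ∈ Z, iteratedDeriv k f t = 0 := by
    intro k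
    induction k with
    | zero => simpa using hfZ
    | succ k ih =>
      intro t ht
      rw [iteratedDeriv_succ]
      exact (hderiv k ih t ht).deriv
  refine contDiff_of_differentiable_iteratedDeriv fun k _ t ↦ ?_
  by_cases ht : t ∈ Z
  · exact (hderiv k (hzero k) t ht).differentiableAt
  · have hopen := hZ.isOpen_compl
    have hdiff := hf.differentiableOn_iteratedDerivWithin (m := k) (mod_cast ENat.natCast_lt_top k)
      hopen.uniqueDiffOn
    exact (hdiff.congr (iteratedDerivWithin_of_isOpen hopen).symm).differentiableAt
      (hopen.mem_nhds ht)

end Flatness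

section Cauchy

lemma norm_iteratedDeriv_cexp_le {Q : ℂ → ℂ} {z : ℂ} {r : ℝ} (hr : 0 < r)
    (hQ : ∀ x ∈ Metric.closedBall z r, DifferentiableAt ℂ Q x)
    (hosc : ∀ x ∈ Metric.closedBall z r, ‖Q x - Q z‖ ≤ 1) (k : ℕ) :
    ‖iteratedDeriv k (fun x ↦ Complex.exp (Q x)) z‖
      ≤ k.factorial * (Real.exp 1 * ‖Complex.exp (Q z)‖) / r ^ k := by
  refine Complex.norm_iteratedDeriv_le_of_forall_mem_sphere_norm_le k hr ?_ fun x hx ↦ ?_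
  · refine DifferentiableOn.diffContOnCl_ball (U := Metric.closedBall z r) (fun x hx ↦ ?_) le_rfl
    exact (hQ x hx).cexp.differentiableWithinAt
  · have hre := (Complex.re_le_norm _).trans (hosc x (Metric.sphere_subset_closedBall hx))
    rw [Complex.sub_re, sub_le_iff_le_add] at hre
    rw [Complex.norm_exp, Complex.norm_exp, ← Real.exp_add]
    exact Real.exp_le_exp.2 hre

lemma iteratedDeriv_comp_ofReal {f : ℂ → ℂ} {t : ℝ} (hf : AnalyticAt ℂ f t) (k : ℕ) :
    iteratedDeriv k (fun s : ℝ ↦ f s) t = iteratedDeriv k f t := by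
  induction k generalizing f with
  | zero => simp
  | succ k ih =>
    have hderiv : deriv (fun s : ℝ ↦ f s) =ᶠ[𝓝 t] fun s : ℝ ↦ deriv f s := by
      filter_upwards [Complex.continuous_ofReal.continuousAt.eventually
        hf.eventually_analyticAt] with s hs
      exact hs.differentiableAt.hasDerivAt.comp_ofReal.deriv
    rw [iteratedDeriv_succ', hderiv.iteratedDeriv_eq, ih hf.deriv, ← iteratedDeriv_succ']

end Cauchy

section Herglotz

variable {α : Type*} [MeasurableSpace α]

/-- The Herglotz integral of `μ` with poles at the points `w a`. The choice `w ζ = ζ` on the circle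
gives the exponent of a singular inner function. -/
noncomputable def herglotz (μ : Measure α) (w : α → ℂ) (z : ℂ) : ℂ :=
  ∫ a, (w a + z) / (w a - z) ∂μ

/-- The exponential of minus a Herglotz integral: both `S_ν` and the functions approximating `1`
are of this form. -/
noncomputable def herglotzExp (μ : Measure α) (w : α → ℂ) (z : ℂ) : ℂ :=
  Complex.exp (-herglotz μ w z)

lemma singularInner_eq_herglotzExp (ν : Measure Circle) :
    singularInner ν = herglotzExp ν (fun ζ ↦ (ζ : ℂ)) :=
  rfl

lemma norm_herglotzExp (μ : Measure α) (w : α → ℂ) (z : ℂ) :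
    ‖herglotzExp μ w z‖ = Real.exp (-(herglotz μ w z).re) := by
  rw [herglotzExp, Complex.norm_exp, Complex.neg_re]

lemma herglotz_smul_measure (c : NNReal) (μ : Measure α) (w : α → ℂ) (z : ℂ) :
    herglotz (c • μ) w z = c * herglotz μ w z := by
  rw [herglotz, integral_smul_nnreal_measure, NNReal.smul_def, Complex.real_smul, herglotz]

lemma tendsto_herglotzExp_smul_measure (μ : Measure α) (w : α → ℂ) (z : ℂ) {ι : Type*}
    {l : Filter ι} {c : ι → NNReal} (hc : Tendsto c l (𝓝 0)) :
    Tendsto (fun i ↦ herglotzExp (c i • μ) w z) l (𝓝 1) := by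
  have h : Tendsto (fun i ↦ ((c i : ℝ) : ℂ)) l (𝓝 0) := by
    have hcont : Continuous fun x : NNReal ↦ ((x : ℝ) : ℂ) := by fun_prop
    exact (hcont.tendsto' 0 0 (by simp)).comp hc
  simpa [herglotzExp, herglotz_smul_measure] using (h.mul_const (herglotz μ w z)).neg.cexp

variable {μ : Measure α} {w : α → ℂ} {z : ℂ} {m : ℝ}

lemma norm_div_sub_le {w z : ℂ} {m : ℝ} (hm : 0 < m) (h : m ≤ ‖w - z‖) :
    ‖w / (w - z)‖ ≤ 1 + ‖z‖ / m := by
  have hne : w - z ≠ 0 := norm_pos_iff.1 (hm.trans_le h)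
  have heq : w / (w - z) = 1 + z / (w - z) := by
    field_simp
    ring
  rw [heq]
  refine (norm_add_le _ _).trans ?_
  rw [norm_one, norm_div]
  gcongr

lemma re_add_div_sub (w z : ℂ) :
    ((w + z) / (w - z)).re = (‖w‖ ^ 2 - ‖z‖ ^ 2) / ‖w - z‖ ^ 2 := by
  have h := congrFun (poissonKernel_eq_re_herglotzRieszKernel (c := 0) (w := z)) w
  simpa [poissonKernel_def, herglotzRieszKernel_def] using h.symm

lemma measurable_add_div_sub (hw : Measurable w) (z : ℂ) :
    Measurable fun a ↦ (w a + z) / (w a - z) :=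
  (hw.add_const z).div (hw.sub_const z)

variable [IsFiniteMeasure μ]

lemma integrable_add_div_sub (hw : Measurable w) (hm : 0 < m) (hz : ∀ᵐ a ∂μ, m ≤ ‖w a - z‖) :
    Integrable (fun a ↦ (w a + z) / (w a - z)) μ := by
  refine .of_bound (measurable_add_div_sub hw z).aestronglyMeasurable (1 + 2 * ‖z‖ / m) ?_
  filter_upwards [hz] with a ha
  have hne : w a - z ≠ 0 := norm_pos_iff.1 (hm.trans_le ha)
  have heq : (w a + z) / (w a - z) = 1 + 2 * z / (w a - z) := by
    field_simp
    ring
  rw [heq]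
  refine (norm_add_le _ _).trans ?_
  rw [norm_one, norm_div, norm_mul, Complex.norm_ofNat]
  gcongr

lemma re_herglotz (hw : Measurable w) (hm : 0 < m) (hz : ∀ᵐ a ∂μ, m ≤ ‖w a - z‖) :
    (herglotz μ w z).re = ∫ a, (‖w a‖ ^ 2 - ‖z‖ ^ 2) / ‖w a - z‖ ^ 2 ∂μ := by
  simp_rw [← re_add_div_sub]
  exact (integral_re (integrable_add_div_sub hw hm hz)).symm

lemma norm_herglotz_sub_le (hw : Measurable w) {z' : ℂ} {m' : ℝ} (hm : 0 < m) (hm' : 0 < m')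
    (hz : ∀ᵐ a ∂μ, m ≤ ‖w a - z‖) (hz' : ∀ᵐ a ∂μ, m' ≤ ‖w a - z'‖) :
    ‖herglotz μ w z' - herglotz μ w z‖
      ≤ 2 * (1 + ‖z‖ / m) / m' * ‖z' - z‖ * μ.real Set.univ := by
  rw [herglotz, herglotz, ← integral_sub (integrable_add_div_sub hw hm' hz')
    (integrable_add_div_sub hw hm hz)]
  refine norm_integral_le_of_norm_le_const ?_
  filter_upwards [hz, hz'] with a ha ha'
  have hne : w a - z ≠ 0 := norm_pos_iff.1 (hm.trans_le ha)
  have hne' : w a - z' ≠ 0 := norm_pos_iff.1 (hm'.trans_le ha')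
  have heq : (w a + z') / (w a - z') - (w a + z) / (w a - z)
      = 2 * (w a / (w a - z)) / (w a - z') * (z' - z) := by
    field_simp
    ring
  rw [heq, norm_mul, norm_div, norm_mul, Complex.norm_ofNat]
  gcongr
  exact norm_div_sub_le hm ha

lemma hasDerivAt_add_div_sub {w z : ℂ} (h : w - z ≠ 0) :
    HasDerivAt (fun x ↦ (w + x) / (w - x)) (2 * w / (w - z) ^ 2) z := by
  refine (((hasDerivAt_id' z).const_add w).div ((hasDerivAt_id' z).const_sub w) h).congr_deriv ?_
  ring

lemma differentiableAt_herglotz (hw : Measurable w) (hm : 0 < m)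
    (hz : ∀ᵐ a ∂μ, m ≤ ‖w a - z‖) : DifferentiableAt ℂ (herglotz μ w) z := by
  have hhalf : 0 < m / 2 := half_pos hm
  have hball : ∀ᵐ a ∂μ, ∀ x ∈ Metric.ball z (m / 2), m / 2 ≤ ‖w a - x‖ := by
    filter_upwards [hz] with a ha x hx
    have htri := norm_sub_le_norm_sub_add_norm_sub (w a) x z
    rw [mem_ball_iff_norm] at hx
    linarith
  refine (hasDerivAt_integral_of_dominated_loc_of_deriv_le
    (F' := fun x a ↦ 2 * w a / (w a - x) ^ 2)
    (bound := fun _ ↦ 2 * (1 + (‖z‖ + m / 2) / (m / 2)) / (m / 2))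
    (Metric.ball_mem_nhds z hhalf)
    (.of_forall fun x ↦ (measurable_add_div_sub hw x).aestronglyMeasurable)
    (integrable_add_div_sub hw hm hz)
    ((hw.const_mul 2).div ((hw.sub_const z).pow_const 2)).aestronglyMeasurable
    ?_ (integrable_const _) ?_).2.differentiableAt
  · filter_upwards [hball] with a ha x hx
    have hxz : ‖x‖ ≤ ‖z‖ + m / 2 := by
      have htri := norm_le_norm_add_norm_sub' x z
      rw [mem_ball_iff_norm] at hx
      linarith
    have heq : 2 * w a / (w a - x) ^ 2 = 2 * (w a / (w a - x)) / (w a - x) := by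
      rw [sq, ← div_div, mul_div_assoc]
    rw [heq, norm_div, norm_mul, Complex.norm_ofNat]
    gcongr
    exacts [(norm_div_sub_le hhalf (ha x hx)).trans (by gcongr), ha x hx]
  · filter_upwards [hball] with a ha x hx
    exact hasDerivAt_add_div_sub (norm_pos_iff.1 (hhalf.trans_le (ha x hx)))

end Herglotz

section ArcLength

lemma arcLength_eq_map (s : ℝ) :
    arcLength = (volume.restrict (Set.Ioc s (s + 2 * Real.pi))).map Circle.exp := by
  have : Fact (0 < 2 * Real.pi) := ⟨Real.two_pi_pos⟩
  have hmap (t : ℝ) : (volume.restrict (Set.Ioc t (t + 2 * Real.pi))).map Circle.exp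
      = (volume : Measure (AddCircle (2 * Real.pi))).map AddCircle.homeomorphCircle' := by
    rw [← (AddCircle.measurePreserving_mk (2 * Real.pi) t).map_eq,
      Measure.map_map AddCircle.homeomorphCircle'.continuous.measurable
        (AddCircle.measurePreserving_mk (2 * Real.pi) t).measurable]
    rfl
  rw [arcLength, hmap s, ← hmap (-Real.pi)]
  congr 3
  ring

instance : IsFiniteMeasure arcLength := by
  unfold arcLength
  infer_instance

lemma arcLength_apply (s : ℝ) {A : Set Circle} (hA : MeasurableSet A) :
    arcLength A = volume (Circle.exp ⁻¹' A ∩ Set.Ioc s (s + 2 * Real.pi)) := by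
  rw [arcLength_eq_map s, Measure.map_apply Circle.exp.continuous.measurable hA,
    Measure.restrict_apply (Circle.exp.continuous.measurable hA)]

lemma norm_circleExp_sub_circleExp (s t : ℝ) :
    ‖(Circle.exp s : ℂ) - Circle.exp t‖ = 2 * |Real.sin ((s - t) / 2)| := by
  have heq : (Circle.exp s : ℂ) - Circle.exp t
      = Circle.exp t * (Complex.exp (Complex.I * (s - t : ℝ)) - 1) := by
    rw [mul_sub, mul_one, Circle.coe_exp, Circle.coe_exp, ← Complex.exp_add]
    congr 2
    push_cast
    ring
  rw [heq, norm_mul, Circle.norm_coe, one_mul, Complex.norm_exp_I_mul_ofReal_sub_one,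
    Real.norm_eq_abs, abs_mul, abs_two]

lemma norm_circleExp_sub_circleExp_le (s t : ℝ) :
    ‖(Circle.exp s : ℂ) - Circle.exp t‖ ≤ |s - t| := by
  have hsin : |Real.sin ((s - t) / 2)| ≤ |(s - t) / 2| := Real.abs_sin_le_abs
  rw [abs_div, abs_two] at hsin
  rw [norm_circleExp_sub_circleExp]
  linarith

lemma mul_abs_le_norm_circleExp_sub_circleExp {s t : ℝ} (h : |s - t| ≤ Real.pi) :
    2 / Real.pi * |s - t| ≤ ‖(Circle.exp s : ℂ) - Circle.exp t‖ := by
  have habs : |(s - t) / 2| = |s - t| / 2 := by rw [abs_div, abs_two]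
  have hsin := Real.mul_abs_le_abs_sin (x := (s - t) / 2) (by rw [habs]; linarith)
  rw [habs] at hsin
  rw [norm_circleExp_sub_circleExp]
  linarith

lemma norm_cexp_mul_I_sub_circleExp_le {τ : ℂ} {t : ℝ} (h : ‖τ - t‖ ≤ 1) :
    ‖Complex.exp (τ * Complex.I) - Circle.exp t‖ ≤ 2 * ‖τ - t‖ := by
  have heq : Complex.exp (τ * Complex.I) - Circle.exp t
      = Circle.exp t * (Complex.exp ((τ - t) * Complex.I) - 1) := by
    rw [mul_sub, mul_one, Circle.coe_exp, ← Complex.exp_add]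
    congr 2
    ring
  have hnorm : ‖(τ - t) * Complex.I‖ = ‖τ - t‖ := by rw [norm_mul, Complex.norm_I, mul_one]
  rw [heq, norm_mul, Circle.norm_coe, one_mul, ← hnorm]
  exact Complex.norm_exp_sub_one_le (hnorm.trans_le h)

lemma ofReal_two_mul_le_arcLength {h : ℝ} (hπ : h ≤ Real.pi) (ξ : Circle) :
    ENNReal.ofReal (2 * h) ≤ arcLength {ζ : Circle | ‖(ζ : ℂ) - ξ‖ ≤ h} := by
  obtain ⟨θ, rfl⟩ := Circle.exp_surjective ξ
  rw [arcLength_apply (θ - Real.pi) (by measurability)]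
  calc ENNReal.ofReal (2 * h) = volume (Set.Ioc (θ - h) (θ + h)) := by
        rw [Real.volume_Ioc]
        congr 1
        ring
    _ ≤ _ := measure_mono fun t ht ↦ ?_
  refine ⟨?_, by linarith [ht.1], by linarith [ht.2]⟩
  exact (norm_circleExp_sub_circleExp_le t θ).trans
    (abs_le.2 ⟨by linarith [ht.1], by linarith [ht.2]⟩)

lemma exists_circle_norm_sub_eq {z : ℂ} (hz : ‖z‖ ≤ 1) :
    ∃ ξ : Circle, ‖(ξ : ℂ) - z‖ = 1 - ‖z‖ := by
  refine ⟨Circle.exp z.arg, ?_⟩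
  have heq : Circle.exp z.arg - z = ((1 - ‖z‖ : ℝ) : ℂ) * Circle.exp z.arg := by
    nth_rw 2 [← Complex.norm_mul_exp_arg_mul_I z]
    rw [Circle.coe_exp]
    push_cast
    ring
  rw [heq, norm_mul, Circle.norm_coe, mul_one, Complex.norm_of_nonneg (sub_nonneg.2 hz)]

end ArcLength

section Distance

variable {E : Set Circle} {z : ℂ}

/-- The distance from `z` to a subset `E` of the circle, truncated at `2`. On the closed disc the
truncation matters only for `E = ∅`, where the value is `2`. -/
noncomputable def distTo (E : Set Circle) (z : ℂ) : ℝ :=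
  (min 2 (Metric.infEDist z ((fun e : Circle ↦ (e : ℂ)) '' E))).toReal

lemma min_two_ne_top (x : ENNReal) : min 2 x ≠ ⊤ :=
  ne_top_of_le_ne_top ENNReal.ofNat_ne_top (min_le_left _ _)

lemma distTo_nonneg (E : Set Circle) (z : ℂ) : 0 ≤ distTo E z :=
  ENNReal.toReal_nonneg

lemma distTo_le_two (E : Set Circle) (z : ℂ) : distTo E z ≤ 2 :=
  ENNReal.toReal_mono ENNReal.ofNat_ne_top (min_le_left _ _)

lemma distTo_le_norm_sub {e : Circle} (he : e ∈ E) (z : ℂ) : distTo E z ≤ ‖z - e‖ := by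
  rw [← dist_eq_norm, dist_edist]
  exact ENNReal.toReal_mono (edist_ne_top _ _)
    ((min_le_right _ _).trans (Metric.infEDist_le_edist_of_mem (Set.mem_image_of_mem _ he)))

lemma le_distTo {c : ℝ} (h2 : c ≤ 2) (h : ∀ e ∈ E, c ≤ ‖z - e‖) : c ≤ distTo E z := by
  rw [distTo, ← ENNReal.ofReal_le_iff_le_toReal (min_two_ne_top _), le_min_iff,
    Metric.le_infEDist, Set.forall_mem_image]
  refine ⟨ENNReal.ofReal_le_of_le_toReal h2, fun e he ↦ ?_⟩
  rw [edist_dist, dist_eq_norm]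
  exact ENNReal.ofReal_le_ofReal (h e he)

lemma distTo_le_distTo_add_norm_sub (E : Set Circle) (x y : ℂ) :
    distTo E x ≤ distTo E y + ‖x - y‖ := by
  rw [← sub_le_iff_le_add]
  refine le_distTo (by linarith [distTo_le_two E x, norm_nonneg (x - y)]) fun e he ↦ ?_
  linarith [distTo_le_norm_sub he x, norm_sub_le_norm_sub_add_norm_sub x y (e : ℂ)]

lemma continuous_distTo (E : Set Circle) : Continuous (distTo E) := by
  refine (LipschitzWith.of_le_add fun x y ↦ ?_).continuous
  rw [dist_eq_norm]
  exact distTo_le_distTo_add_norm_sub E x y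

lemma distTo_coe_pos (hE : IsClosed E) {ζ : Circle} (hζ : ζ ∉ E) : 0 < distTo E ζ := by
  have hclosed : IsClosed ((fun e : Circle ↦ (e : ℂ)) '' E) :=
    (hE.isCompact.image (by fun_prop)).isClosed
  have hnot : (ζ : ℂ) ∉ closure ((fun e : Circle ↦ (e : ℂ)) '' E) := by
    rw [hclosed.closure_eq]
    rintro ⟨e, he, h⟩
    exact hζ (Circle.coe_injective h ▸ he)
  exact ENNReal.toReal_pos (lt_min two_pos (Metric.infEDist_pos_iff_notMem_closure.2 hnot)).ne'
    (min_two_ne_top _)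

lemma one_sub_norm_le_distTo (E : Set Circle) (z : ℂ) : 1 - ‖z‖ ≤ distTo E z := by
  refine le_distTo (by linarith [norm_nonneg z]) fun e _ ↦ ?_
  have h := norm_sub_norm_le (e : ℂ) z
  rwa [Circle.norm_coe, norm_sub_rev] at h

lemma distTo_pos_of_norm_lt_one (E : Set Circle) (hz : ‖z‖ < 1) : 0 < distTo E z :=
  (sub_pos.2 hz).trans_le (one_sub_norm_le_distTo E z)

lemma two_div_pi_mul_min_le_distTo {a b t : ℝ} (hba : b - a ≤ 2 * Real.pi)
    (hab : ∀ s ∈ Set.Ioo a b, Circle.exp s ∉ E) :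
    2 / Real.pi * min (t - a) (b - t) ≤ distTo E (Circle.exp t) := by
  have hπ := Real.pi_pos
  refine le_distTo ?_ fun e he ↦ ?_
  · rw [div_mul_eq_mul_div, div_le_iff₀ hπ]
    linarith [min_le_left (t - a) (b - t), min_le_right (t - a) (b - t)]
  set x := Complex.arg (e * (Circle.exp t)⁻¹ : Circle) with hx
  have hexp : Circle.exp (t + x) = e := by
    rw [Circle.exp_add, hx, Circle.exp_arg, mul_comm, inv_mul_cancel_right]
  have hxπ : |t - (t + x)| ≤ Real.pi := by
    rw [sub_add_cancel_left, abs_neg]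
    exact Complex.abs_arg_le_pi _
  have hmin : min (t - a) (b - t) ≤ |t - (t + x)| := by
    by_contra! hlt
    rw [lt_min_iff, abs_lt, abs_lt] at hlt
    exact hab (t + x) ⟨by linarith, by linarith⟩ (hexp ▸ he)
  calc 2 / Real.pi * min (t - a) (b - t) ≤ 2 / Real.pi * |t - (t + x)| := by gcongr
    _ ≤ ‖(Circle.exp t : ℂ) - Circle.exp (t + x)‖ := mul_abs_le_norm_circleExp_sub_circleExp hxπ
    _ = ‖(Circle.exp t : ℂ) - e‖ := by rw [hexp]

end Distance

section Entropy

variable {E : Set Circle}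

/-- The circle cut at `e^{is}`, in angular coordinates `s < t < s + 2π`. -/
noncomputable def angularChart (s : ℝ) : OpenPartialHomeomorph ℝ Circle :=
  have : Fact (0 < 2 * Real.pi) := ⟨Real.two_pi_pos⟩
  (AddCircle.openPartialHomeomorphCoe (2 * Real.pi) s).trans
    AddCircle.homeomorphCircle'.toOpenPartialHomeomorph

lemma angularChart_source (s : ℝ) :
    (angularChart s).source = Set.Ioo s (s + 2 * Real.pi) := by
  simp [angularChart]

lemma angularChart_target (s : ℝ) : (angularChart s).target = {Circle.exp s}ᶜ := by
  have : Fact (0 < 2 * Real.pi) := ⟨Real.two_pi_pos⟩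
  ext z
  have hz : AddCircle.homeomorphCircle'.symm z = (s : AddCircle (2 * Real.pi))
      ↔ z = Circle.exp s := Homeomorph.symm_apply_eq _
  simpa [angularChart] using hz.not

lemma coe_angularChart (s : ℝ) : ⇑(angularChart s) = Circle.exp := rfl

lemma exists_eq_Ioo_of_isOpen_isConnected {J : Set ℝ} (ho : IsOpen J) (hc : IsConnected J)
    (hb : BddBelow J) (ha : BddAbove J) : ∃ a b : ℝ, a < b ∧ J = Set.Ioo a b := by
  have hJ : J = Set.Ioo (sInf J) (sSup J) := by
    refine Set.Subset.antisymm ?_ (hc.Ioo_csInf_csSup_subset hb ha)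
    rw [← interior_Icc]
    exact interior_maximal (subset_Icc_csInf_csSup hb ha) ho
  obtain ⟨x, hx⟩ := hc.nonempty
  rw [hJ] at hx
  exact ⟨_, _, hx.1.trans hx.2, hJ⟩

lemma isOpen_of_mem_complementaryArcs (hE : IsClosed E) {I : Set Circle}
    (hI : I ∈ complementaryArcs E) : IsOpen I := by
  have := ChartedSpace.locallyConnectedSpace (EuclideanSpace ℝ (Fin 1)) Circle
  obtain ⟨ξ, -, rfl⟩ := hI
  exact hE.isOpen_compl.connectedComponentIn

lemma isConnected_of_mem_complementaryArcs {I : Set Circle} (hI : I ∈ complementaryArcs E) :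
    IsConnected I := by
  obtain ⟨ξ, hξ, rfl⟩ := hI
  exact ⟨⟨ξ, mem_connectedComponentIn hξ⟩, isPreconnected_connectedComponentIn⟩

lemma subset_compl_of_mem_complementaryArcs {I : Set Circle} (hI : I ∈ complementaryArcs E) :
    I ⊆ Eᶜ := by
  obtain ⟨ξ, -, rfl⟩ := hI
  exact connectedComponentIn_subset _ _

lemma pairwise_disjoint_complementaryArcs (E : Set Circle) :
    Pairwise (Function.onFun Disjoint fun I : complementaryArcs E ↦ (I : Set Circle)) := by
  rintro ⟨_, ξ, hξ, rfl⟩ ⟨_, η, hη, rfl⟩ hne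
  refine Set.disjoint_left.2 fun x hx hy ↦ hne (Subtype.ext ?_)
  exact (connectedComponentIn_eq hx).trans (connectedComponentIn_eq hy).symm

lemma countable_complementaryArcs (hE : IsClosed E) : Countable (complementaryArcs E) :=
  (pairwise_disjoint_complementaryArcs E).countable_of_isOpen_disjoint
    (fun I ↦ isOpen_of_mem_complementaryArcs hE I.2)
    fun I ↦ (isConnected_of_mem_complementaryArcs I.2).nonempty

lemma iUnion_complementaryArcs (E : Set Circle) :
    ⋃ I : complementaryArcs E, (I : Set Circle) = Eᶜ := by
  refine (Set.iUnion_subset fun I ↦ subset_compl_of_mem_complementaryArcs I.2).antisymm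
    fun ξ hξ ↦ Set.mem_iUnion.2 ⟨⟨_, ξ, hξ, rfl⟩, mem_connectedComponentIn hξ⟩

lemma exists_Ioo_of_mem_complementaryArcs (hE : IsClosed E) {s : ℝ} (hs : Circle.exp s ∈ E)
    {I : Set Circle} (hI : I ∈ complementaryArcs E) :
    ∃ a b : ℝ, a < b ∧ Circle.exp ⁻¹' I ∩ Set.Ioc s (s + 2 * Real.pi) = Set.Ioo a b := by
  have hIE : ∀ t, Circle.exp t ∈ I → Circle.exp t ∉ E := fun t ↦
    (subset_compl_of_mem_complementaryArcs hI ·)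
  have htarget : I ⊆ (angularChart s).target := by
    rw [angularChart_target, Set.subset_compl_singleton_iff]
    exact fun h ↦ hIE s h hs
  have himage := (angularChart s).symm_image_eq_source_inter_preimage htarget
  rw [angularChart_source, coe_angularChart] at himage
  have hJ : Circle.exp ⁻¹' I ∩ Set.Ioc s (s + 2 * Real.pi) = (angularChart s).symm '' I := by
    rw [himage, Set.inter_comm]
    refine Set.Subset.antisymm (fun t ht ↦ ⟨⟨ht.1.1, ht.1.2.lt_of_ne ?_⟩, ht.2⟩)
      (Set.inter_subset_inter_left _ Set.Ioo_subset_Ioc_self)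
    rintro rfl
    exact hIE _ ht.2 ((Circle.exp_add_two_pi s).symm ▸ hs)
  rw [hJ]
  refine exists_eq_Ioo_of_isOpen_isConnected ?_ ?_ (hJ ▸ bddBelow_Ioc.mono Set.inter_subset_right)
    (hJ ▸ bddAbove_Ioc.mono Set.inter_subset_right)
  · exact (angularChart s).isOpen_image_symm_of_subset_target
      (isOpen_of_mem_complementaryArcs hE hI) htarget
  · exact (isConnected_of_mem_complementaryArcs hI).image _
      ((angularChart s).continuousOn_symm.mono htarget)

lemma measurable_log_two_div_distTo (E : Set Circle) :
    Measurable fun ζ : Circle ↦ ENNReal.ofReal (Real.log (2 / distTo E ζ)) := by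
  have hdist : Measurable fun ζ : Circle ↦ distTo E ζ :=
    ((continuous_distTo E).comp (by fun_prop)).measurable
  exact (Real.measurable_log.comp (hdist.const_div 2)).ennreal_ofReal

lemma log_two_div_distTo_nonneg {z : ℂ} (h : 0 < distTo E z) : 0 ≤ Real.log (2 / distTo E z) :=
  Real.log_nonneg ((one_le_div h).2 (distTo_le_two E z))

/-- An antiderivative-friendly majorant of `log (2 / d)` on a complementary arc `(a, b)`. -/
noncomputable def arcLogMajorant (a b t : ℝ) : ℝ :=
  Real.log Real.pi - Real.log (t - a) - Real.log (b - t) + Real.log (b - a)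

lemma log_two_div_distTo_le (hE : IsClosed E) {a b : ℝ} (hba : b - a ≤ 2 * Real.pi)
    (hab : ∀ s ∈ Set.Ioo a b, Circle.exp s ∉ E) {t : ℝ} (ht : t ∈ Set.Ioo a b) :
    Real.log (2 / distTo E (Circle.exp t)) ≤ arcLogMajorant a b t := by
  have hat : 0 < t - a := sub_pos.2 ht.1
  have htb : 0 < b - t := sub_pos.2 ht.2
  have hab' : 0 < b - a := by linarith
  have hd : 0 < distTo E (Circle.exp t) := distTo_coe_pos hE (hab t ht)
  have hπ := Real.pi_pos
  have hprod : (t - a) * (b - t) ≤ min (t - a) (b - t) * (b - a) := by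
    rcases le_total (t - a) (b - t) with h | h
    · rw [min_eq_left h]; gcongr; linarith
    · rw [min_eq_right h, mul_comm]; gcongr; linarith
  have hmin : 2 * min (t - a) (b - t) ≤ Real.pi * distTo E (Circle.exp t) := by
    have h := two_div_pi_mul_min_le_distTo hba hab (t := t)
    rw [div_mul_eq_mul_div, div_le_iff₀ hπ] at h
    linarith
  rw [arcLogMajorant, ← Real.log_div hπ.ne' hat.ne', ← Real.log_div (by positivity) htb.ne',
    ← Real.log_mul (by positivity) hab'.ne']
  refine Real.log_le_log (by positivity) ?_
  rw [div_div, div_mul_eq_mul_div, div_le_div_iff₀ hd (by positivity)]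
  nlinarith

lemma intervalIntegrable_log_sub_left (a b : ℝ) :
    IntervalIntegrable (fun t ↦ Real.log (t - a)) volume a b := by
  simpa using (intervalIntegral.intervalIntegrable_log' (a := 0) (b := b - a)).comp_sub_right a

lemma intervalIntegrable_log_sub_right (a b : ℝ) :
    IntervalIntegrable (fun t ↦ Real.log (b - t)) volume a b := by
  simpa using (intervalIntegral.intervalIntegrable_log' (a := b - a) (b := 0)).comp_sub_left b

lemma intervalIntegrable_arcLogMajorant (a b : ℝ) :
    IntervalIntegrable (arcLogMajorant a b) volume a b :=
  ((intervalIntegrable_const.sub (intervalIntegrable_log_sub_left a b)).sub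
    (intervalIntegrable_log_sub_right a b)).add intervalIntegrable_const

lemma integral_arcLogMajorant (a b : ℝ) :
    ∫ t in a..b, arcLogMajorant a b t
      = (b - a) * (Real.log Real.pi + 2) + (b - a) * Real.log (1 / (b - a)) := by
  have hleft := intervalIntegrable_log_sub_left a b
  have hright := intervalIntegrable_log_sub_right a b
  have hconst (c : ℝ) : IntervalIntegrable (fun _ ↦ c) volume a b := intervalIntegrable_const
  simp only [arcLogMajorant]
  rw [intervalIntegral.integral_add (((hconst _).sub hleft).sub hright) (hconst _),
    intervalIntegral.integral_sub ((hconst _).sub hleft) hright,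
    intervalIntegral.integral_sub (hconst _) hleft,
    intervalIntegral.integral_comp_sub_right (fun t ↦ Real.log t),
    intervalIntegral.integral_comp_sub_left (fun t ↦ Real.log t)]
  simp only [intervalIntegral.integral_const, integral_log, sub_self, smul_eq_mul, zero_mul,
    one_div, Real.log_inv]
  ring

lemma lintegral_log_distTo_le_of_mem_complementaryArcs (hE : IsClosed E) (hne : E.Nonempty)
    {I : Set Circle} (hI : I ∈ complementaryArcs E) :
    ∫⁻ ζ in I, ENNReal.ofReal (Real.log (2 / distTo E ζ)) ∂arcLength
      ≤ ENNReal.ofReal (arcLength.real I * (Real.log Real.pi + 2)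
        + arcLength.real I * Real.log (1 / arcLength.real I)) := by
  obtain ⟨e, he⟩ := hne
  obtain ⟨s, rfl⟩ := Circle.exp_surjective e
  obtain ⟨a, b, hab, hJ⟩ := exists_Ioo_of_mem_complementaryArcs hE he hI
  have hout : ∀ t ∈ Set.Ioo a b, Circle.exp t ∉ E := fun t ht ↦
    subset_compl_of_mem_complementaryArcs hI (hJ ▸ ht).1
  have hba : b - a ≤ 2 * Real.pi := by
    have h : Set.Ioo a b ⊆ Set.Ioc s (s + 2 * Real.pi) := hJ ▸ Set.inter_subset_right
    have hvol := measure_mono (μ := volume) h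
    rw [Real.volume_Ioo, Real.volume_Ioc,
      ENNReal.ofReal_le_ofReal_iff (by linarith [Real.pi_pos])] at hvol
    linarith
  have hIm := (isOpen_of_mem_complementaryArcs hE hI).measurableSet
  have hexp := Circle.exp.continuous.measurable
  have hlen : arcLength.real I = b - a := by
    rw [Measure.real, arcLength_apply s hIm, hJ, Real.volume_Ioo,
      ENNReal.toReal_ofReal (sub_nonneg.2 hab.le)]
  rw [arcLength_eq_map s, setLIntegral_map hIm (measurable_log_two_div_distTo E) hexp,
    Measure.restrict_restrict (hexp hIm), hJ, ← arcLength_eq_map s, hlen,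
    ← integral_arcLogMajorant, intervalIntegral.integral_of_le hab.le,
    integral_Ioc_eq_integral_Ioo, ofReal_integral_eq_lintegral_ofReal]
  · exact setLIntegral_mono' measurableSet_Ioo fun t ht ↦
      ENNReal.ofReal_le_ofReal (log_two_div_distTo_le hE hba hout ht)
  · exact (intervalIntegrable_arcLogMajorant a b).1.mono_set Set.Ioo_subset_Ioc_self
  · refine (ae_restrict_iff' measurableSet_Ioo).2 (.of_forall fun t ht ↦ ?_)
    exact (log_two_div_distTo_nonneg (distTo_coe_pos hE (hout t ht))).trans
      (log_two_div_distTo_le hE hba hout ht)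

lemma summable_arcLength_complementaryArcs (hE : IsClosed E) :
    Summable fun I : complementaryArcs E ↦ arcLength.real (I : Set Circle) := by
  have := countable_complementaryArcs hE
  refine ENNReal.summable_toReal ?_
  rw [← measure_iUnion (pairwise_disjoint_complementaryArcs E)
    fun I ↦ (isOpen_of_mem_complementaryArcs hE I.2).measurableSet]
  exact measure_ne_top _ _

lemma distTo_empty (z : ℂ) : distTo ∅ z = 2 :=
  (distTo_le_two _ _).antisymm (le_distTo le_rfl (by simp))

lemma lintegral_log_distTo_lt_top (hE : IsBeurlingCarleson E) :
    ∫⁻ ζ : Circle, ENNReal.ofReal (Real.log (2 / distTo E ζ)) ∂arcLength < ⊤ := by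
  rcases E.eq_empty_or_nonempty with rfl | hne
  · simp [distTo_empty]
  have := countable_complementaryArcs hE.isClosed
  have hnull : arcLength.restrict Eᶜ = arcLength :=
    Measure.restrict_eq_self_of_ae_mem (compl_mem_ae_iff.2 hE.null)
  rw [← hnull, ← iUnion_complementaryArcs, lintegral_iUnion
    (fun I ↦ (isOpen_of_mem_complementaryArcs hE.isClosed I.2).measurableSet)
    (pairwise_disjoint_complementaryArcs E)]
  refine (ENNReal.tsum_le_tsum fun I ↦
    lintegral_log_distTo_le_of_mem_complementaryArcs hE.isClosed hne I.2).trans_lt ?_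
  exact (((summable_arcLength_complementaryArcs hE.isClosed).mul_right _).add
    hE.entropy).tsum_ofReal_lt_top

end Entropy

section Majorant

variable {α : Type*} {f : α → ENNReal}

/-- The sum of the tails of `f` above the levels `K j`. -/
noncomputable def tailSum (K : ℕ → ℕ) (f : α → ENNReal) (x : α) : ENNReal :=
  ∑' j, {x | (K j : ENNReal) ≤ f x}.indicator f x

lemma mul_le_tailSum {K : ℕ → ℕ} {N : ℕ} {x : α}
    (hx : ∀ j < N, (K j : ENNReal) ≤ f x) : N * f x ≤ tailSum K f x := by
  refine le_trans ?_ (ENNReal.sum_le_tsum (Finset.range N))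
  have hterm : ∀ j ∈ Finset.range N, {x | (K j : ENNReal) ≤ f x}.indicator f x = f x :=
    fun j hj ↦ Set.indicator_of_mem (by exact hx j (Finset.mem_range.1 hj)) f
  rw [Finset.sum_congr rfl hterm, Finset.sum_const, Finset.card_range, nsmul_eq_mul]

variable [MeasurableSpace α] {m : Measure α}

lemma measurable_tailSum (K : ℕ → ℕ) (hf : Measurable f) : Measurable (tailSum K f) :=
  .tsum fun _ ↦ hf.indicator (measurableSet_le measurable_const hf)

lemma lintegral_tailSum (K : ℕ → ℕ) (hf : Measurable f) :
    ∫⁻ x, tailSum K f x ∂m = ∑' j, ∫⁻ x in {x | (K j : ENNReal) ≤ f x}, f x ∂m := by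
  have hms (j : ℕ) : MeasurableSet {x | (K j : ENNReal) ≤ f x} :=
    measurableSet_le measurable_const hf
  simp only [tailSum]
  rw [lintegral_tsum fun j ↦ (hf.indicator (hms j)).aemeasurable]
  simp_rw [lintegral_indicator (hms _)]

lemma exists_nat_setLIntegral_lt (hf : Measurable f) (hint : ∫⁻ x, f x ∂m ≠ ⊤) {ε : ENNReal}
    (hε : ε ≠ 0) : ∃ K : ℕ, ∫⁻ x in {x | (K : ENNReal) ≤ f x}, f x ∂m < ε := by
  obtain ⟨δ, hδ, hsmall⟩ := exists_pos_setLIntegral_lt_of_measure_lt hint hε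
  obtain ⟨K, hK⟩ := ENNReal.exists_nat_gt (ENNReal.div_ne_top hint hδ.ne')
  refine ⟨K, hsmall _ ((meas_ge_le_lintegral_div hf.aemeasurable (pos_of_gt hK).ne'
    (ENNReal.natCast_ne_top K)).trans_lt (ENNReal.div_lt_of_lt_mul ?_))⟩
  rw [mul_comm]
  exact (ENNReal.div_lt_iff (.inl hδ.ne') (.inr hint)).1 hK

lemma exists_superlinear_majorant (hf : Measurable f) (hint : ∫⁻ x, f x ∂m ≠ ⊤) :
    ∃ g : α → ENNReal, Measurable g ∧ ∫⁻ x, g x ∂m ≠ ⊤ ∧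
      ∀ N : ℕ, ∃ K : ℕ, ∀ x, K ≤ f x → N * f x ≤ g x := by
  choose K hK using fun j : ℕ ↦ exists_nat_setLIntegral_lt hf hint
    (pow_ne_zero j (ENNReal.inv_ne_zero.2 ENNReal.ofNat_ne_top) : (2⁻¹ : ENNReal) ^ j ≠ 0)
  refine ⟨tailSum K f, measurable_tailSum K hf, ?_, fun N ↦ ?_⟩
  · rw [lintegral_tailSum K hf]
    refine ((ENNReal.tsum_le_tsum fun j ↦ (hK j).le).trans_lt ?_).ne
    rw [ENNReal.tsum_geometric]
    simp
  · refine ⟨(Finset.range N).sup K, fun x hx ↦ mul_le_tailSum fun j hj ↦ le_trans ?_ hx⟩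
    exact_mod_cast Finset.le_sup (f := K) (Finset.mem_range.2 hj)

end Majorant

section Superlogarithmic

variable {E : Set Circle} {μ : Measure Circle}

/-- Near `E` the measure `μ` is denser than every multiple of `log (1 / dist(·, E))` times arc
length. Composing with a Herglotz kernel, this forces decay faster than every power. -/
def IsSuperlogarithmic (E : Set Circle) (μ : Measure Circle) : Prop :=
  ∀ N : ℕ, ∀ᶠ t in 𝓝[>] (0 : ℝ), ∀ A : Set Circle, MeasurableSet A →
    (∀ ζ ∈ A, distTo E ζ ≤ t) → N * ENNReal.ofReal (Real.log (1 / t)) * arcLength A ≤ μ A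

lemma IsSuperlogarithmic.smul (h : IsSuperlogarithmic E μ) {c : NNReal} (hc : 0 < c) :
    IsSuperlogarithmic E (c • μ) := by
  intro N
  obtain ⟨M, hM⟩ := exists_nat_ge (N / c : NNReal)
  have hNM : (N : ENNReal) ≤ c * M := by
    rw [div_le_iff₀ hc, mul_comm] at hM
    exact_mod_cast hM
  filter_upwards [h M] with t ht A hA hAt
  calc N * ENNReal.ofReal (Real.log (1 / t)) * arcLength A
      ≤ c * M * ENNReal.ofReal (Real.log (1 / t)) * arcLength A := by gcongr
    _ = c * (M * ENNReal.ofReal (Real.log (1 / t)) * arcLength A) := by simp only [mul_assoc]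
    _ ≤ c * μ A := by gcongr; exact ht A hA hAt
    _ = (c • μ) A := by rw [Measure.smul_apply, ENNReal.smul_def, smul_eq_mul]

lemma isSuperlogarithmic_withDensity (hE : IsClosed E) (hnull : arcLength E = 0)
    {g : Circle → ENNReal} (hg : ∀ N : ℕ, ∃ K : ℕ, ∀ ζ : Circle,
      K ≤ ENNReal.ofReal (Real.log (2 / distTo E ζ)) →
        N * ENNReal.ofReal (Real.log (2 / distTo E ζ)) ≤ g ζ) :
    IsSuperlogarithmic E (arcLength.withDensity g) := by
  intro N
  obtain ⟨K, hK⟩ := hg N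
  filter_upwards [Ioo_mem_nhdsGT (Real.exp_pos (-K))] with t ⟨ht, htK⟩ A hA hAt
  have hKt : (K : ℝ) ≤ Real.log (1 / t) := by
    rw [one_div, Real.log_inv, le_neg, ← Real.log_exp (-K)]
    exact Real.log_le_log ht htK.le
  rw [withDensity_apply _ hA, ← setLIntegral_const]
  refine setLIntegral_mono_ae' hA ?_
  filter_upwards [measure_eq_zero_iff_ae_notMem.1 hnull] with ζ hζ hζA
  have hpos : 0 < distTo E ζ := distTo_coe_pos hE hζ
  have hlog : Real.log (1 / t) ≤ Real.log (2 / distTo E ζ) := by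
    refine Real.log_le_log (by positivity) ?_
    gcongr
    exacts [one_le_two, hAt ζ hζA]
  refine le_trans (by gcongr) (hK ζ ?_)
  rw [← ENNReal.ofReal_natCast]
  exact ENNReal.ofReal_le_ofReal (hKt.trans hlog)

lemma IsBeurlingCarleson.exists_isSuperlogarithmic (hE : IsBeurlingCarleson E) :
    ∃ μ : Measure Circle, IsFiniteMeasure μ ∧ IsSuperlogarithmic E μ := by
  obtain ⟨g, -, hgint, hg⟩ := exists_superlinear_majorant (measurable_log_two_div_distTo E)
    (lintegral_log_distTo_lt_top hE).ne
  exact ⟨arcLength.withDensity g, isFiniteMeasure_withDensity hgint,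
    isSuperlogarithmic_withDensity hE.isClosed hE.null hg⟩

end Superlogarithmic

section PolesAway

variable {E : Set Circle} {α : Type*} [MeasurableSpace α] {μ : Measure α} {w : α → ℂ} {z : ℂ}

/-- The poles `w a` stay away from the points `z` of the closed disc, in proportion to the distance
of `z` to `E`. -/
structure PolesAway (E : Set Circle) (μ : Measure α) (w : α → ℂ) : Prop where
  measurable : Measurable w
  le_norm_sub : ∀ᵐ a ∂μ, ∀ z : ℂ, ‖z‖ ≤ 1 → distTo E z / 3 ≤ ‖w a - z‖

lemma polesAway_coe {ν : Measure Circle} (hν : ν Eᶜ = 0) :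
    PolesAway E ν (fun ζ ↦ (ζ : ℂ)) := by
  refine ⟨by fun_prop, ?_⟩
  filter_upwards [show ∀ᵐ ζ ∂ν, ζ ∈ E from hν] with ζ hζ z _
  have hle := distTo_le_norm_sub hζ z
  rw [norm_sub_rev] at hle
  linarith [distTo_nonneg E z]

namespace PolesAway

lemma one_le_norm (h : PolesAway E μ w) : ∀ᵐ a ∂μ, 1 ≤ ‖w a‖ := by
  filter_upwards [h.le_norm_sub] with a ha
  by_contra! hlt
  have hle := ha (w a) hlt.le
  rw [sub_self, norm_zero] at hle
  linarith [distTo_pos_of_norm_lt_one E hlt]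

lemma ae_div_three_le_norm_sub (h : PolesAway E μ w) (hz : ‖z‖ ≤ 1) :
    ∀ᵐ a ∂μ, distTo E z / 3 ≤ ‖w a - z‖ :=
  h.le_norm_sub.mono fun _ ha ↦ ha z hz

lemma ae_poisson_nonneg (h : PolesAway E μ w) (hz : ‖z‖ ≤ 1) :
    ∀ᵐ a ∂μ, 0 ≤ (‖w a‖ ^ 2 - ‖z‖ ^ 2) / ‖w a - z‖ ^ 2 := by
  filter_upwards [h.one_le_norm] with a ha
  have hsq : ‖z‖ ^ 2 ≤ ‖w a‖ ^ 2 := by gcongr; exact hz.trans ha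
  exact div_nonneg (sub_nonneg.2 hsq) (sq_nonneg _)

variable [IsFiniteMeasure μ]

lemma mul_measureReal_le_re_herglotz (h : PolesAway E μ w) (hz : ‖z‖ ≤ 1)
    (hd : 0 < distTo E z) {A : Set α} (hA : MeasurableSet A) {c : ℝ}
    (hc : ∀ a ∈ A, c ≤ (‖w a‖ ^ 2 - ‖z‖ ^ 2) / ‖w a - z‖ ^ 2) :
    c * μ.real A ≤ (herglotz μ w z).re := by
  have hd3 : 0 < distTo E z / 3 := by positivity
  have hm := h.ae_div_three_le_norm_sub hz
  have hint := (integrable_add_div_sub h.measurable hd3 hm).re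
  simp only [RCLike.re_to_complex, re_add_div_sub] at hint
  calc c * μ.real A = ∫ _ in A, c ∂μ := by rw [setIntegral_const, smul_eq_mul, mul_comm]
    _ ≤ ∫ a in A, (‖w a‖ ^ 2 - ‖z‖ ^ 2) / ‖w a - z‖ ^ 2 ∂μ :=
      setIntegral_mono_on integrableOn_const hint.integrableOn hA hc
    _ ≤ ∫ a, (‖w a‖ ^ 2 - ‖z‖ ^ 2) / ‖w a - z‖ ^ 2 ∂μ :=
      setIntegral_le_integral hint (h.ae_poisson_nonneg hz)
    _ = (herglotz μ w z).re := (re_herglotz h.measurable hd3 hm).symm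

lemma norm_herglotzExp_le_one (h : PolesAway E μ w) (hz : ‖z‖ ≤ 1) (hd : 0 < distTo E z) :
    ‖herglotzExp μ w z‖ ≤ 1 := by
  have hre := h.mul_measureReal_le_re_herglotz hz hd MeasurableSet.empty (c := 0) (by simp)
  rw [norm_herglotzExp, Real.exp_le_one_iff, neg_nonpos]
  linarith

end PolesAway

end PolesAway

section Decay

variable {E : Set Circle} {μ : Measure Circle} {z : ℂ}

/-- The point `(1 + dist(ζ, E)) ζ`, outside the closed disc unless `ζ ∈ E`. Moving the mass of a
measure there makes its Herglotz integral analytic across `𝕋 \ E`. -/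
noncomputable def pole (E : Set Circle) (ζ : Circle) : ℂ := (1 + distTo E ζ : ℝ) * ζ

lemma measurable_pole (E : Set Circle) : Measurable (pole E) := by
  have := continuous_distTo E
  unfold pole
  fun_prop

lemma norm_pole (E : Set Circle) (ζ : Circle) : ‖pole E ζ‖ = 1 + distTo E ζ := by
  rw [pole, norm_mul, Circle.norm_coe, mul_one,
    Complex.norm_of_nonneg (by linarith [distTo_nonneg E ζ])]

lemma norm_pole_sub_coe (E : Set Circle) (ζ : Circle) : ‖pole E ζ - ζ‖ = distTo E ζ := by
  have heq : pole E ζ - ζ = (distTo E ζ : ℂ) * ζ := by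
    rw [pole]
    push_cast
    ring
  rw [heq, norm_mul, Circle.norm_coe, mul_one, Complex.norm_of_nonneg (distTo_nonneg E ζ)]

lemma norm_pole_sub_le (E : Set Circle) (ζ : Circle) (z : ℂ) :
    ‖pole E ζ - z‖ ≤ distTo E ζ + ‖(ζ : ℂ) - z‖ := by
  rw [← norm_pole_sub_coe]
  exact norm_sub_le_norm_sub_add_norm_sub _ _ _

lemma distTo_div_three_le_norm_pole_sub (E : Set Circle) (ζ : Circle) (hz : ‖z‖ ≤ 1) :
    distTo E z / 3 ≤ ‖pole E ζ - z‖ := by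
  have hlip := distTo_le_distTo_add_norm_sub E z ζ
  have htri := norm_sub_le_norm_sub_add_norm_sub z (pole E ζ) ζ
  have hrad := norm_sub_norm_le (pole E ζ) z
  rw [norm_pole] at hrad
  rw [norm_pole_sub_coe, norm_sub_rev z (pole E ζ)] at htri
  linarith

lemma polesAway_pole (E : Set Circle) (μ : Measure Circle) : PolesAway E μ (pole E) :=
  ⟨measurable_pole E, .of_forall fun ζ _ ↦ distTo_div_three_le_norm_pole_sub E ζ⟩

lemma norm_sub_le_of_norm_sub_le {ξ ζ : Circle} (hξ : ‖(ξ : ℂ) - z‖ = 1 - ‖z‖)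
    (hζ : ‖(ζ : ℂ) - ξ‖ ≤ distTo E z / 2) :
    ‖(ζ : ℂ) - z‖ ≤ distTo E z / 2 + (1 - ‖z‖) := by
  linarith [norm_sub_le_norm_sub_add_norm_sub (ζ : ℂ) ξ z]

lemma le_poisson_pole (hz : ‖z‖ ≤ 1) (hd : 0 < distTo E z) {ζ : Circle}
    (hζ : ‖(ζ : ℂ) - z‖ ≤ distTo E z / 2 + (1 - ‖z‖)) :
    1 / (32 * distTo E z) ≤ (‖pole E ζ‖ ^ 2 - ‖z‖ ^ 2) / ‖pole E ζ - z‖ ^ 2 := by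
  have hzd := one_sub_norm_le_distTo E z
  have hupper := distTo_le_distTo_add_norm_sub E ζ z
  have hlower := distTo_le_distTo_add_norm_sub E z ζ
  rw [norm_sub_rev] at hlower
  have hden : ‖pole E ζ - z‖ ≤ 4 * distTo E z := by linarith [norm_pole_sub_le E ζ z]
  have hden0 : 0 < ‖pole E ζ - z‖ := by linarith [distTo_div_three_le_norm_pole_sub E ζ hz]
  have hnum : distTo E z / 2 ≤ ‖pole E ζ‖ ^ 2 - ‖z‖ ^ 2 := by
    rw [norm_pole]
    nlinarith [norm_nonneg z, distTo_nonneg E (ζ : ℂ)]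
  calc 1 / (32 * distTo E z) = distTo E z / 2 / (4 * distTo E z) ^ 2 := by field_simp; norm_num
    _ ≤ _ := by gcongr; linarith

/-- In the closed disc, `f` vanishes on `E` to infinite order. -/
def VanishesRapidly (E : Set Circle) (f : ℂ → ℂ) : Prop :=
  ∀ N : ℕ, ∃ C : ℝ, 0 ≤ C ∧ ∀ z : ℂ, ‖z‖ ≤ 1 → 0 < distTo E z → ‖f z‖ ≤ C * distTo E z ^ N

variable [IsFiniteMeasure μ]

lemma exists_measureReal_le_re_herglotz_pole (hz : ‖z‖ ≤ 1) (hd : 0 < distTo E z) :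
    ∃ A : Set Circle, MeasurableSet A ∧ (∀ ζ ∈ A, distTo E ζ ≤ 3 * distTo E z) ∧
      ENNReal.ofReal (distTo E z) ≤ arcLength A ∧
      1 / (32 * distTo E z) * μ.real A ≤ (herglotz μ (pole E) z).re := by
  obtain ⟨ξ, hξ⟩ := exists_circle_norm_sub_eq hz
  have hA : MeasurableSet {ζ : Circle | ‖(ζ : ℂ) - ξ‖ ≤ distTo E z / 2} := by measurability
  refine ⟨_, hA, fun ζ hζ ↦ ?_, ?_, ?_⟩
  · linarith [norm_sub_le_of_norm_sub_le hξ hζ, distTo_le_distTo_add_norm_sub E ζ z,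
      one_sub_norm_le_distTo E z]
  · have harc := ofReal_two_mul_le_arcLength
      (by linarith [distTo_le_two E z, Real.pi_gt_three] : distTo E z / 2 ≤ Real.pi) ξ
    rwa [mul_div_cancel₀ _ two_ne_zero] at harc
  · exact (polesAway_pole E μ).mul_measureReal_le_re_herglotz hz hd hA fun ζ hζ ↦
      le_poisson_pole hz hd (norm_sub_le_of_norm_sub_le hξ hζ)

lemma IsSuperlogarithmic.eventually_mul_log_le_re_herglotz (hμ : IsSuperlogarithmic E μ) (N : ℕ) :
    ∀ᶠ t in 𝓝[>] (0 : ℝ), ∀ z : ℂ, ‖z‖ ≤ 1 → 3 * distTo E z = t →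
      N * Real.log (1 / t) ≤ (herglotz μ (pole E) z).re := by
  filter_upwards [hμ (32 * N), Ioo_mem_nhdsGT one_pos] with t hμt ⟨ht, ht1⟩ z hz hzt
  have hd : 0 < distTo E z := by linarith
  obtain ⟨A, hA, hAt, harc, hre⟩ := exists_measureReal_le_re_herglotz_pole (μ := μ) hz hd
  have hlog : 0 ≤ Real.log (1 / t) := Real.log_nonneg ((one_le_div ht).2 ht1.le)
  have hmass : (32 * N : ℕ) * Real.log (1 / t) * distTo E z ≤ μ.real A := by
    refine (ENNReal.ofReal_le_iff_le_toReal (measure_ne_top μ A)).1 (le_trans ?_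
      (hμt A hA fun ζ hζ ↦ (hAt ζ hζ).trans_eq hzt))
    rw [ENNReal.ofReal_mul (by positivity), ENNReal.ofReal_mul (by positivity),
      ENNReal.ofReal_natCast]
    gcongr
  calc N * Real.log (1 / t)
      = 1 / (32 * distTo E z) * ((32 * N : ℕ) * Real.log (1 / t) * distTo E z) := by
        push_cast
        field_simp
    _ ≤ 1 / (32 * distTo E z) * μ.real A := by gcongr
    _ ≤ _ := hre

lemma IsSuperlogarithmic.vanishesRapidly_herglotzExp (hμ : IsSuperlogarithmic E μ) :
    VanishesRapidly E (herglotzExp μ (pole E)) := by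
  intro N
  obtain ⟨r, hr, hlog⟩ :=
    mem_nhdsGT_iff_exists_Ioo_subset.1 (hμ.eventually_mul_log_le_re_herglotz N)
  rw [Set.mem_Ioi] at hr
  refine ⟨3 ^ N + (3 / r) ^ N, by positivity, fun z hz hd ↦ ?_⟩
  rw [add_mul, ← mul_pow, ← mul_pow]
  rcases lt_or_ge (3 * distTo E z) r with hlt | hge
  · have hre := hlog ⟨by positivity, hlt⟩ z hz rfl
    have hexp : Real.exp (-(N * Real.log (1 / (3 * distTo E z)))) = (3 * distTo E z) ^ N := by
      rw [one_div, Real.log_inv, mul_neg, neg_neg, Real.exp_nat_mul, Real.exp_log (by positivity)]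
    rw [norm_herglotzExp]
    calc Real.exp (-(herglotz μ (pole E) z).re) ≤ (3 * distTo E z) ^ N := by
          rw [← hexp]
          gcongr
      _ ≤ _ := le_add_of_nonneg_right (by positivity)
  · calc ‖herglotzExp μ (pole E) z‖ ≤ 1 := (polesAway_pole E μ).norm_herglotzExp_le_one hz hd
      _ ≤ (3 / r * distTo E z) ^ N :=
        one_le_pow₀ (by rwa [div_mul_eq_mul_div, one_le_div hr])
      _ ≤ _ := le_add_of_nonneg_left (by positivity)

end Decay

section Derivatives

variable {E : Set Circle} {α β : Type*} [MeasurableSpace α] [MeasurableSpace β]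
  {μ : Measure α} [IsFiniteMeasure μ] {w : α → ℂ} {ν : Measure β} [IsFiniteMeasure ν] {v : β → ℂ}
  {z : ℂ}

namespace PolesAway

lemma exists_norm_herglotz_sub_le_one (h : PolesAway E μ w) :
    ∃ η : ℝ, 0 < η ∧ η ≤ 1 / 12 ∧ ∀ z x : ℂ, ‖z‖ ≤ 1 → 0 < distTo E z →
      ‖x - z‖ ≤ η * distTo E z ^ 2 →
        DifferentiableAt ℂ (herglotz μ w) x ∧ ‖herglotz μ w x - herglotz μ w z‖ ≤ 1 := by
  set M := μ.real Set.univ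
  have hM : 0 ≤ M := measureReal_nonneg
  refine ⟨1 / (12 + 60 * M), by positivity, by gcongr; linarith, fun z x hz hd hx ↦ ?_⟩
  set d := distTo E z
  have hd2 : d ≤ 2 := distTo_le_two E z
  have hxd : ‖x - z‖ ≤ d / 6 := by
    calc ‖x - z‖ ≤ 1 / (12 + 60 * M) * d ^ 2 := hx
      _ ≤ 1 / 12 * d ^ 2 := by gcongr; linarith
      _ ≤ d / 6 := by nlinarith
  have hmz := h.ae_div_three_le_norm_sub hz
  have hmx : ∀ᵐ a ∂μ, d / 6 ≤ ‖w a - x‖ := by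
    filter_upwards [hmz] with a ha
    linarith [norm_sub_le_norm_sub_add_norm_sub (w a) x z]
  have hd3 : 0 < d / 3 := by positivity
  have hd6 : 0 < d / 6 := by positivity
  refine ⟨differentiableAt_herglotz h.measurable hd6 hmx, ?_⟩
  calc ‖herglotz μ w x - herglotz μ w z‖
      ≤ 2 * (1 + ‖z‖ / (d / 3)) / (d / 6) * ‖x - z‖ * M :=
        norm_herglotz_sub_le h.measurable hd3 hd6 hmz hmx
    _ ≤ 2 * (1 + 1 / (d / 3)) / (d / 6) * (1 / (12 + 60 * M) * d ^ 2) * M := by gcongr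
    _ = 12 * (d + 3) * M / (12 + 60 * M) := by
      field_simp
      ring
    _ ≤ 1 := by
      rw [div_le_one (by positivity)]
      nlinarith

lemma analyticAt_herglotzExp (h : PolesAway E μ w) (hz : ‖z‖ ≤ 1) (hd : 0 < distTo E z) :
    AnalyticAt ℂ (herglotzExp μ w) z := by
  obtain ⟨η, hη, -, hosc⟩ := h.exists_norm_herglotz_sub_le_one
  refine Complex.analyticAt_iff_eventually_differentiableAt.2 ?_
  filter_upwards [Metric.closedBall_mem_nhds z (mul_pos hη (pow_pos hd 2))] with x hx
  exact (hosc z x hz hd (mem_closedBall_iff_norm.1 hx)).1.neg.cexp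

lemma exists_norm_iteratedDeriv_herglotzExp_le (h : PolesAway E μ w) (k : ℕ) :
    ∃ C : ℝ, 0 ≤ C ∧ ∀ z : ℂ, ‖z‖ ≤ 1 → 0 < distTo E z →
      ‖iteratedDeriv k (herglotzExp μ w) z‖ ≤ C * ‖herglotzExp μ w z‖ / (distTo E z ^ 2) ^ k := by
  obtain ⟨η, hη, -, hosc⟩ := h.exists_norm_herglotz_sub_le_one
  refine ⟨k.factorial * Real.exp 1 / η ^ k, by positivity, fun z hz hd ↦ ?_⟩
  have hball : ∀ x ∈ Metric.closedBall z (η * distTo E z ^ 2),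
      DifferentiableAt ℂ (herglotz μ w) x ∧ ‖herglotz μ w x - herglotz μ w z‖ ≤ 1 :=
    fun x hx ↦ hosc z x hz hd (mem_closedBall_iff_norm.1 hx)
  have hcauchy := norm_iteratedDeriv_cexp_le (Q := fun x ↦ -herglotz μ w x) (by positivity)
    (fun x hx ↦ (hball x hx).1.neg)
    (fun x hx ↦ by rw [neg_sub_neg, norm_sub_rev]; exact (hball x hx).2) k
  refine hcauchy.trans_eq ?_
  rw [mul_pow, herglotzExp]
  field_simp

lemma analyticAt_herglotzExp_cexp_mul_I (h : PolesAway E μ w) {t : ℝ}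
    (hd : 0 < distTo E (Circle.exp t)) :
    AnalyticAt ℂ (fun τ : ℂ ↦ herglotzExp μ w (Complex.exp (τ * Complex.I))) t := by
  have hG := h.analyticAt_herglotzExp (Circle.norm_coe _).le hd
  exact AnalyticAt.comp_of_eq (g := herglotzExp μ w) (f := fun τ : ℂ ↦ Complex.exp (τ * Complex.I))
    hG (by fun_prop) (Circle.coe_exp t).symm

lemma contDiffAt_herglotzExp_circleExp (h : PolesAway E μ w) {t : ℝ}
    (hd : 0 < distTo E (Circle.exp t)) :
    ContDiffAt ℝ ∞ (fun s : ℝ ↦ herglotzExp μ w (Circle.exp s)) t := by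
  have hanalytic := (h.analyticAt_herglotzExp_cexp_mul_I hd).contDiffAt (n := ∞)
  simp only [Circle.coe_exp]
  exact (hanalytic.restrict_scalars ℝ).comp t Complex.ofRealCLM.contDiff.contDiffAt

lemma exists_norm_iteratedDeriv_herglotzExp_circleExp_le (h : PolesAway E μ w) (k : ℕ) :
    ∃ C : ℝ, ∀ t : ℝ, 0 < distTo E (Circle.exp t) →
      ‖iteratedDeriv k (fun s : ℝ ↦ herglotzExp μ w (Circle.exp s)) t‖
        ≤ C * ‖herglotzExp μ w (Circle.exp t)‖ / (distTo E (Circle.exp t) ^ 2) ^ k := by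
  obtain ⟨η, hη, hη12, hosc⟩ := h.exists_norm_herglotz_sub_le_one
  refine ⟨k.factorial * Real.exp 1 / (η / 2) ^ k, fun t hd ↦ ?_⟩
  set d := distTo E (Circle.exp t)
  have hd2 : d ≤ 2 := distTo_le_two E _
  have hηd : η * d ^ 2 ≤ 1 / 12 * 2 ^ 2 := by gcongr
  have hball : ∀ τ ∈ Metric.closedBall (t : ℂ) (η / 2 * d ^ 2),
      DifferentiableAt ℂ (herglotz μ w) (Complex.exp (τ * Complex.I)) ∧
        ‖herglotz μ w (Complex.exp (τ * Complex.I)) - herglotz μ w (Circle.exp t)‖ ≤ 1 := by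
    intro τ hτ
    rw [mem_closedBall_iff_norm] at hτ
    exact hosc _ _ (Circle.norm_coe _).le hd
      ((norm_cexp_mul_I_sub_circleExp_le (by linarith)).trans (by linarith))
  have hcauchy := norm_iteratedDeriv_cexp_le (z := t)
    (Q := fun τ ↦ -herglotz μ w (Complex.exp (τ * Complex.I))) (by positivity)
    (fun τ hτ ↦ (DifferentiableAt.comp (g := herglotz μ w) τ (hball τ hτ).1 (by fun_prop)).neg)
    (fun τ hτ ↦ by
      rw [neg_sub_neg, norm_sub_rev, ← Circle.coe_exp]
      exact (hball τ hτ).2) k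
  simp only [Circle.coe_exp]
  rw [iteratedDeriv_comp_ofReal (h.analyticAt_herglotzExp_cexp_mul_I hd)]
  refine hcauchy.trans_eq ?_
  rw [mul_pow, herglotzExp]
  field_simp

lemma exists_norm_iteratedDeriv_mul_conj_circleExp_le (hv : PolesAway E ν v)
    (hw : PolesAway E μ w) (k : ℕ) :
    ∃ C : ℝ, 0 ≤ C ∧ ∀ t : ℝ, 0 < distTo E (Circle.exp t) →
      ‖iteratedDeriv k (fun s : ℝ ↦ herglotzExp ν v (Circle.exp s)
          * (starRingEnd ℂ) (herglotzExp μ w (Circle.exp s))) t‖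
        ≤ C * ‖herglotzExp μ w (Circle.exp t)‖ / (distTo E (Circle.exp t) ^ 2) ^ k := by
  choose a ha using hv.exists_norm_iteratedDeriv_herglotzExp_circleExp_le
  choose b hb using hw.exists_norm_iteratedDeriv_herglotzExp_circleExp_le
  refine ⟨|∑ i ∈ Finset.range (k + 1), k.choose i * a i * b (k - i)|, abs_nonneg _, fun t hd ↦ ?_⟩
  have hconj (i : ℕ) := norm_iteratedDeriv_linearIsometryEquiv_comp Complex.conjLIE
    (fun s : ℝ ↦ herglotzExp μ w (Circle.exp s)) i t
  simp only [Complex.conjLIE_apply] at hconj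
  have hle := (mod_cast le_top : ((k : ℕ∞) : WithTop ℕ∞) ≤ ∞)
  refine (norm_iteratedDeriv_mul_le_of_le
    ((hv.contDiffAt_herglotzExp_circleExp hd).of_le hle)
    (Complex.conjLIE.contDiff.contDiffAt.comp t
      ((hw.contDiffAt_herglotzExp_circleExp hd).of_le hle))
    (fun i ↦ ha i t hd) (fun i ↦ (hconj i).trans_le (hb i t hd))).trans ?_
  gcongr
  · exact le_abs_self _
  · exact mul_le_of_le_one_left (norm_nonneg _)
      (hv.norm_herglotzExp_le_one (Circle.norm_coe _).le hd)

end PolesAway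

end Derivatives

section Regularity

variable {E : Set Circle} {α β : Type*} [MeasurableSpace α] [MeasurableSpace β]
  {μ : Measure α} [IsFiniteMeasure μ] {w : α → ℂ} {ν : Measure β} [IsFiniteMeasure ν] {v : β → ℂ}

lemma PolesAway.smoothOnCircle_mul_conj (hE : IsClosed E) (hv : PolesAway E ν v)
    (hw : PolesAway E μ w) (hflat : VanishesRapidly E (herglotzExp μ w)) :
    SmoothOnCircle (Eᶜ.indicator fun ζ ↦
      herglotzExp ν v ζ * (starRingEnd ℂ) (herglotzExp μ w ζ)) := by
  have hZ : IsClosed (Circle.exp ⁻¹' E) := hE.preimage Circle.exp.continuous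
  set f := fun s : ℝ ↦ herglotzExp ν v (Circle.exp s)
    * (starRingEnd ℂ) (herglotzExp μ w (Circle.exp s))
  set u := Eᶜ.indicator fun ζ : Circle ↦
    herglotzExp ν v ζ * (starRingEnd ℂ) (herglotzExp μ w ζ)
  have huf {t : ℝ} (ht : t ∉ Circle.exp ⁻¹' E) : (fun s ↦ u (Circle.exp s)) =ᶠ[𝓝 t] f := by
    filter_upwards [hZ.isOpen_compl.mem_nhds ht] with s hs
    exact Set.indicator_of_mem (s := Eᶜ) (a := Circle.exp s) hs _
  refine contDiff_of_flat hZ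
    (fun t ht ↦ Set.indicator_of_notMem (s := Eᶜ) (a := Circle.exp t) (Set.notMem_compl_iff.2 ht) _)
    (fun t ht ↦ ContDiffAt.contDiffWithinAt ?_) fun k ↦ ?_
  · have hd := distTo_coe_pos hE ht
    exact ((hv.contDiffAt_herglotzExp_circleExp hd).mul (Complex.conjLIE.contDiff.contDiffAt.comp t
      (hw.contDiffAt_herglotzExp_circleExp hd))).congr_of_eventuallyEq (huf ht)
  · obtain ⟨A, hA, hf⟩ := hv.exists_norm_iteratedDeriv_mul_conj_circleExp_le hw k
    obtain ⟨C, hC, hdecay⟩ := hflat (2 * k + 2)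
    refine ⟨A * C, fun t ht s hs ↦ ?_⟩
    have hd := distTo_coe_pos hE ht
    have hts : distTo E (Circle.exp t) ≤ ‖t - s‖ :=
      (distTo_le_norm_sub hs _).trans (norm_circleExp_sub_circleExp_le t s)
    rw [(huf ht).iteratedDeriv_eq]
    calc ‖iteratedDeriv k f t‖
        ≤ A * ‖herglotzExp μ w (Circle.exp t)‖ / (distTo E (Circle.exp t) ^ 2) ^ k := hf t hd
      _ ≤ A * (C * distTo E (Circle.exp t) ^ (2 * k + 2))
          / (distTo E (Circle.exp t) ^ 2) ^ k := by
        gcongr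
        exact hdecay _ (Circle.norm_coe _).le hd
      _ = A * C * distTo E (Circle.exp t) ^ 2 := by
        rw [← pow_mul, pow_add]
        field_simp
      _ ≤ A * C * ‖t - s‖ ^ 2 := by gcongr

lemma continuousOn_indicator_of_norm_le {X F : Type*} [TopologicalSpace X]
    [NormedAddCommGroup F] {d : X → ℝ} (hd : Continuous d) (hd0 : ∀ x, 0 ≤ d x) {g : X → F}
    {s : Set X} (hg : ∀ x ∈ s, 0 < d x → ContinuousAt g x) {C : ℝ} (hC : 0 ≤ C)
    (hgC : ∀ x ∈ s, 0 < d x → ‖g x‖ ≤ C * d x) :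
    ContinuousOn ({x | 0 < d x}.indicator g) s := by
  intro x hx
  rcases (hd0 x).eq_or_lt with hx0 | hx0
  · have hgx : {x | 0 < d x}.indicator g x = 0 :=
      Set.indicator_of_notMem (s := {x | 0 < d x}) hx0.not_lt g
    rw [ContinuousWithinAt, hgx]
    have hlim : Tendsto (fun y ↦ C * d y) (𝓝[s] x) (𝓝 0) :=
      ((hd.const_mul C).tendsto' x 0 (by simp [← hx0])).mono_left nhdsWithin_le_nhds
    refine squeeze_zero_norm' ?_ hlim
    filter_upwards [self_mem_nhdsWithin] with y hy
    rw [norm_indicator_eq_indicator_norm]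
    exact Set.indicator_apply_le' (hgC y hy) fun _ ↦ mul_nonneg hC (hd0 y)
  · refine ((hg x hx hx0).congr ?_).continuousWithinAt
    filter_upwards [hd.continuousAt.eventually_const_lt hx0] with y hy
    exact (Set.indicator_of_mem (s := {x | 0 < d x}) hy g).symm

lemma PolesAway.memAInfty_herglotzExp (h : PolesAway E μ w)
    (hflat : VanishesRapidly E (herglotzExp μ w)) : MemAInfty (herglotzExp μ w) := by
  intro k _
  have hball {z : ℂ} (hz : z ∈ Metric.ball (0 : ℂ) 1) : 0 < distTo E z :=
    distTo_pos_of_norm_lt_one E (mem_ball_zero_iff.1 hz)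
  obtain ⟨A, hA, hf⟩ := h.exists_norm_iteratedDeriv_herglotzExp_le k
  obtain ⟨C, hC, hdecay⟩ := hflat (2 * k + 1)
  refine ⟨fun z hz ↦ (h.analyticAt_herglotzExp (mem_ball_zero_iff.1 hz).le
    (hball hz)).differentiableAt.differentiableWithinAt,
    {z | 0 < distTo E z}.indicator (iteratedDeriv k (herglotzExp μ w)),
    continuousOn_indicator_of_norm_le (continuous_distTo E) (distTo_nonneg E) (fun z hz hd ↦ ?_)
      (mul_nonneg hA hC) fun z hz hd ↦ ?_,
    fun z hz ↦ Set.indicator_of_mem (s := {z | 0 < distTo E z}) (hball hz) _⟩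
  all_goals rw [mem_closedBall_zero_iff] at hz
  · rw [iteratedDeriv_eq_iterate]
    exact ((h.analyticAt_herglotzExp hz hd).iterated_deriv k).continuousAt
  · calc ‖iteratedDeriv k (herglotzExp μ w) z‖
        ≤ A * ‖herglotzExp μ w z‖ / (distTo E z ^ 2) ^ k := hf z hz hd
      _ ≤ A * (C * distTo E z ^ (2 * k + 1)) / (distTo E z ^ 2) ^ k := by
        gcongr
        exact hdecay z hz hd
      _ = A * C * distTo E z := by
        rw [← pow_mul, pow_succ]
        field_simp

lemma hasBoundaryFunction_of_continuousAt (hE : arcLength E = 0) {f : ℂ → ℂ} {u : Circle → ℂ}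
    (hf : ∀ ζ : Circle, ζ ∉ E → ContinuousAt f ζ) (hu : ∀ ζ : Circle, ζ ∉ E → f ζ = u ζ) :
    HasBoundaryFunction f u := by
  filter_upwards [measure_eq_zero_iff_ae_notMem.1 hE] with ζ hζ M _
  rw [← hu ζ hζ]
  exact (hf ζ hζ).tendsto.mono_left nhdsWithin_le_nhds

lemma PolesAway.continuousAt_herglotzExp_coe (h : PolesAway E μ w) (hE : IsClosed E) {ζ : Circle}
    (hζ : ζ ∉ E) : ContinuousAt (herglotzExp μ w) ζ :=
  (h.analyticAt_herglotzExp (Circle.norm_coe ζ).le (distTo_coe_pos hE hζ)).continuousAt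

end Regularity

end ModelSpace

theorem mainTheorem4 (ν : MeasureTheory.Measure Circle) [MeasureTheory.IsFiniteMeasure ν]
    (E : Set Circle) (hE : ModelSpace.IsBeurlingCarleson E) (hν : ν Eᶜ = 0) :
    ∃ H : ℕ → ℂ → ℂ,
      (∀ n, ModelSpace.MemAInfty (H n)) ∧
      (∀ n, ∃ u : Circle → ℂ, ModelSpace.SmoothOnCircle u ∧
        ModelSpace.HasBoundaryFunction
          (fun z ↦ ModelSpace.singularInner ν z * (starRingEnd ℂ) (H n z)) u) ∧
      (∃ b : ℕ → Circle → ℂ, (∀ n, ModelSpace.HasBoundaryFunction (H n) (b n)) ∧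
        ∀ᵐ ζ ∂ModelSpace.arcLength,
          Filter.Tendsto (fun n ↦ b n ζ) Filter.atTop (nhds 1)) ∧
      (∃ C : ℝ, ∀ n, ∀ z ∈ Metric.ball (0 : ℂ) 1, ‖H n z‖ ≤ C) := by
  open ModelSpace in
  obtain ⟨μ, _, hμ⟩ := hE.exists_isSuperlogarithmic
  set c : ℕ → NNReal := fun n ↦ 1 / (n + 1)
  set H : ℕ → ℂ → ℂ := fun n ↦ herglotzExp (c n • μ) (pole E)
  have hpoles (n : ℕ) : PolesAway E (c n • μ) (pole E) := polesAway_pole E _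
  have hflat (n : ℕ) : VanishesRapidly E (H n) :=
    (hμ.smul (by positivity)).vanishesRapidly_herglotzExp
  have hS := polesAway_coe hν
  have hcont (n : ℕ) (ζ : Circle) (hζ : ζ ∉ E) : ContinuousAt (H n) ζ :=
    (hpoles n).continuousAt_herglotzExp_coe hE.isClosed hζ
  refine ⟨H, fun n ↦ (hpoles n).memAInfty_herglotzExp (hflat n),
    fun n ↦ ⟨_, hS.smoothOnCircle_mul_conj hE.isClosed (hpoles n) (hflat n), ?_⟩,
    ⟨fun n ζ ↦ H n ζ, fun n ↦ ?_, ?_⟩, 1, fun n z hz ↦ ?_⟩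
  · rw [singularInner_eq_herglotzExp]
    exact hasBoundaryFunction_of_continuousAt hE.null (fun ζ hζ ↦
      (hS.continuousAt_herglotzExp_coe hE.isClosed hζ).mul (hcont n ζ hζ).star)
      fun ζ hζ ↦ by rw [Set.indicator_of_mem (Set.mem_compl hζ)]
  · exact hasBoundaryFunction_of_continuousAt hE.null (hcont n) fun ζ _ ↦ rfl
  · exact .of_forall fun ζ ↦
      tendsto_herglotzExp_smul_measure μ _ _ tendsto_one_div_add_atTop_nhds_zero_nat
  · have hz' := mem_ball_zero_iff.1 hz
    exact (hpoles n).norm_herglotzExp_le_one hz'.le (distTo_pos_of_norm_lt_one E hz')
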